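/- Let $n\ge 0$ and let $\mathbf w=(q_0,\dots,q_n)$ be positive integers (weights); put $q=q_0q_1\cdots q_n$. For a field $F$, the weighted projective space $\mathbb{WP}^n_{\mathbf w}(F)$ is the quotient of $F^{n+1}\setminus\{0\}$ by the action $\lambda\star(x_0,\dots,x_n)=(\lambda^{q_0}x_0,\dots,\lambda^{q_n}x_n)$ of $F^\times$; the class of $(x_0,\dots,x_n)$ is written $[x_0:\dots:x_n]$. Let $\overline{\mathbb Q}$ be an algebraic closure of $\mathbb Q$ and $\mathfrak p=[x_0:\dots:x_n]\in\mathbb{WP}^n_{\mathbf w}(\overline{\mathbb Q})$. The (absolute, multiplicative) weighted height of $\mathfrak p$ is $$\mathfrak h(\mathfrak p)=\Bigl(\prod_{v\in M_K}\max_{0\le j\le n}|x_j|_v^{\,n_v/q_j}\Bigr)^{1/[K:\mathbb Q]},$$ where $K\subset\overline{\mathbb Q}$ is any number field containing $x_0,\dots,x_n$, $M_K$ is the set of places of $K$, $|\cdot|_v$ extends a standard absolute value of $\mathbb Q$, and $n_v=[K_v:\mathbb Q_v]$; this does not depend on the choice of coordinates or of $K$. Put $z_j=x_j^{q/q_j}$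 and choose $i$ with $x_i\ne0$. A field of definition of $\mathfrak p$ is $$\mathbb Q(\mathfrak p)=\mathbb Q\left(\left(\frac{z_0}{z_i}\right)^{q_0/q},\dots,1,\dots,\left(\frac{z_n}{z_i}\right)^{q_n/q}\right),$$ where $(z_j/z_i)^{q_j/q}$ denotes some $y_j\in\overline{\mathbb Q}$ with $y_j^{q/q_j}=z_j/z_i$, and $y_i=1$ is taken in position $i$. This field depends on the choice of the index $i$ and of the roots $y_j$. **Theorem.** For all real constants $c_0$ and $d_0$, there are only finitely many points $\mathfrak p\in\mathbb{WP}^n_{\mathbf w}(\overline{\mathbb Q})$ such that $\mathfrak h(\mathfrak p)\le c_0$ and $[\mathbb Q(\mathfrak p):\mathbb Q]\le d_0$ for at least one choice of the index and of the roots in the definition of $\mathbb Q(\mathfrak p)$. -/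

import Mathlib

open NumberField

noncomputable section

namespace WeightedProj

/-- Nonzero vectors of `F^(n+1)`. -/
abbrev NonzeroVec (n : ℕ) (F : Type*) [Field F] : Type _ := {x : Fin (n + 1) → F // x ≠ 0}

/-- Two nonzero vectors are equivalent if `y = (lam^(w 0) x 0, …, lam^(w n) x n)` for some
`lam` in `Fˣ`. -/
def weightedSetoid {n : ℕ} (w : Fin (n + 1) → ℕ) (F : Type*) [Field F] :
    Setoid (NonzeroVec n F) where
  r x y := ∃ lam : Fˣ, ∀ i, y.1 i = (lam : F) ^ w i * x.1 i
  iseqv :=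
    { refl := fun x => ⟨1, fun i => by simp⟩
      symm := by
        rintro x y ⟨lam, h⟩
        refine ⟨lam⁻¹, fun i => ?_⟩
        rw [h i, ← mul_assoc, ← mul_pow]
        simp
      trans := by
        rintro x y z ⟨lam, h⟩ ⟨mu, k⟩
        refine ⟨mu * lam, fun i => ?_⟩
        rw [k i, h i, Units.val_mul, mul_pow, mul_assoc] }

/-- The set of `F`-points of the weighted projective space: the quotient of `F^(n+1) \ {0}` by
the weighted action of `Fˣ`. -/
def WPSpace {n : ℕ} (w : Fin (n + 1) → ℕ) (F : Type*) [Field F] : Type _ :=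
  Quotient (weightedSetoid w F)

/-- The point with weighted homogeneous coordinates `x`. -/
def WPSpace.mk {n : ℕ} (w : Fin (n + 1) → ℕ) {F : Type*} [Field F] (x : NonzeroVec n F) :
    WPSpace w F :=
  Quotient.mk (weightedSetoid w F) x

/-- Chosen weighted homogeneous coordinates of a point. -/
def WPSpace.rep {n : ℕ} {w : Fin (n + 1) → ℕ} {F : Type*} [Field F] (p : WPSpace w F) :
    NonzeroVec n F :=
  Quotient.out p

theorem WPSpace.mk_rep {n : ℕ} {w : Fin (n + 1) → ℕ} {F : Type*} [Field F] (p : WPSpace w F) :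
    WPSpace.mk w p.rep = p :=
  Quotient.out_eq p

/-- The weighted height over a number field `K`, that is the product over all places `v` of `K`
of `max_i |x i|_v ^ (n_v / w i)`, where `n_v` is the local degree and `|·|_v` extends a standard
absolute value of `ℚ`.

For an infinite place, `n_v` is `v.mult`. Mathlib normalizes a finite place, attached to a prime
`P`, by `v a = (absNorm P) ^ (- ord_P a)`; this is `|a|_v ^ n_v`, so the local degree is already
part of it. -/
def weightedHeight {n : ℕ} (w : Fin (n + 1) → ℕ) (K : Type*) [Field K] [NumberField K]
    (x : Fin (n + 1) → K) : ℝ :=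
  (∏ v : InfinitePlace K, ⨆ i, (v (x i)) ^ ((v.mult : ℝ) / (w i : ℝ))) *
    ∏ᶠ v : FinitePlace K, ⨆ i, (v (x i)) ^ ((1 : ℝ) / (w i : ℝ))

/-- The field generated over `ℚ` by the coordinates of a vector of algebraic numbers. -/
abbrev coordField {Qbar : Type*} [Field Qbar] [CharZero Qbar] {n : ℕ}
    (x : Fin (n + 1) → Qbar) :
    IntermediateField ℚ Qbar :=
  IntermediateField.adjoin ℚ (Set.range x)

instance coordField_finiteDimensional {Qbar : Type*} [Field Qbar] [CharZero Qbar] [IsAlgClosure ℚ Qbar]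
    {n : ℕ} (x : Fin (n + 1) → Qbar) :
    FiniteDimensional ℚ (coordField x) :=
  IntermediateField.finiteDimensional_adjoin
    fun a _ => (Algebra.IsAlgebraic.isAlgebraic (R := ℚ) a).isIntegral

instance coordField_numberField {Qbar : Type*} [Field Qbar] [CharZero Qbar] [IsAlgClosure ℚ Qbar]
    {n : ℕ} (x : Fin (n + 1) → Qbar) :
    NumberField (coordField x) where
  to_finiteDimensional := by
    convert coordField_finiteDimensional x

/-- The coordinates of `x`, seen as elements of the number field that they generate. -/
def coordInField {Qbar : Type*} [Field Qbar] [CharZero Qbar] {n : ℕ}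
    (x : Fin (n + 1) → Qbar) (i : Fin (n + 1)) :
    coordField x :=
  ⟨x i, IntermediateField.subset_adjoin ℚ _ ⟨i, rfl⟩⟩

/-- The absolute weighted height of a vector of algebraic numbers: the weighted height over
`K = ℚ(x 0, …, x n)`, raised to the power `1 / [K : ℚ]`. -/
def absHeightVec {Qbar : Type*} [Field Qbar] [CharZero Qbar] [IsAlgClosure ℚ Qbar] {n : ℕ}
    (w : Fin (n + 1) → ℕ) (x : Fin (n + 1) → Qbar) : ℝ :=
  (weightedHeight w (coordField x) (coordInField x)) ^
    ((1 : ℝ) / (Module.finrank ℚ (coordField x) : ℝ))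

/-- The absolute weighted height of a point with algebraic coordinates. It is computed from one
choice of coordinates and from the number field that these generate; by the product formula and
the degree formula, any other coordinates and any other number field that contains them give the
same value. -/
def absHeight {Qbar : Type*} [Field Qbar] [CharZero Qbar] [IsAlgClosure ℚ Qbar] {n : ℕ}
    {w : Fin (n + 1) → ℕ} (p : WPSpace w Qbar) : ℝ :=
  absHeightVec w p.rep.1

/-- `q / w j`, where `q = w 0 * … * w n`. -/
def coWeight {n : ℕ} (w : Fin (n + 1) → ℕ) (j : Fin (n + 1)) : ℕ :=
  ∏ l ∈ Finset.univ.erase j, w l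

/-- `F` is a field of definition of `p`: for some `i` with `x i ≠ 0`,
`F = ℚ((z 0 / z i)^(w 0 / q), …, 1, …, (z n / z i)^(w n / q))`, where `q = w 0 * … * w n` and
`z j = (x j)^(q / w j)`. Here `(z j / z i)^(w j / q)` is any number `y j` such that
`(y j)^(q / w j) = z j / z i`; the field depends on the choice of these roots. -/
def IsFieldOfDefinition {Qbar : Type*} [Field Qbar] [CharZero Qbar] {n : ℕ}
    {w : Fin (n + 1) → ℕ} (p : WPSpace w Qbar)
    (F : IntermediateField ℚ Qbar) : Prop :=
  ∃ x : NonzeroVec n Qbar, WPSpace.mk w x = p ∧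
    ∃ i : Fin (n + 1), x.1 i ≠ 0 ∧
      ∃ y : Fin (n + 1) → Qbar, y i = 1 ∧
        (∀ j, y j ^ coWeight w j = x.1 j ^ coWeight w j / x.1 i ^ coWeight w i) ∧
        F = IntermediateField.adjoin ℚ (Set.range y)

end WeightedProj

end

/-!
Write `q = w 0 * ⋯ * w n` and `z j = x j ^ (q / w j)`. The ratios `z j / z i` do not depend on the
weighted homogeneous coordinates `x` of the point, and only finitely many points share the same
ratios: scaling to `x i = 1`, which is possible over an algebraically closed field, makes each
`x j` a root of a known number (`WeightedProj.finite_setOf_coordRatio_mem`). So it is enough to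
bound the degree and the height of these ratios and to apply Northcott's theorem.

The ratio `z j / z i` is a power of the generator `y j` of the field of definition, whence its
degree is at most `d₀`. The `q`-th power of the weighted height of `x` is the ordinary projective
height of `z` (`WeightedProj.weightedHeight_pow_prod`), and this bounds the height of `z j / z i`
over `ℚ(x 0, …, x n)`. The degree of that field is not under control, so the estimate is carried
down to `ℚ(z j / z i)` by the base change formula `H_L(a) = H_K(a) ^ [L : K]`
(`NumberField.mulHeight₁_algebraMap`). Its archimedean part counts the extensions of complex
embeddings; its finite part is the formula `N(I 𝓞_L) = N(I) ^ [L : K]` for the ideal `I` generated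
by a numerator and a denominator.

Northcott's theorem for algebraic numbers of bounded degree
(`NumberField.finite_setOf_mulHeight₁_le_of_finrank_le`) holds because the height bounds both a
denominator of `b` and all conjugates of `b`, hence all coefficients of the minimal polynomial of
an integral multiple of `b`.
-/

/-! ### Base change of heights -/

namespace NumberField

/-- A product over the infinite places with multiplicities is a product over the complex embeddings,
since `v.mult` is the number of embeddings that induce `v`. -/
theorem InfinitePlace.prod_pow_mult_eq_prod_embeddings {K : Type*} [Field K] [NumberField K]
    {M : Type*} [CommMonoid M] (f : InfinitePlace K → M) :
    ∏ v : InfinitePlace K, f v ^ v.mult = ∏ φ : K →+* ℂ, f (InfinitePlace.mk φ) := by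
  classical
  rw [← Finset.prod_fiberwise Finset.univ (fun φ : K →+* ℂ => InfinitePlace.mk φ)]
  refine Finset.prod_congr rfl fun v _ => ?_
  rw [Finset.prod_congr rfl (g := fun _ => f v)
    (fun φ hφ => by rw [(Finset.mem_filter.1 hφ).2]), Finset.prod_const,
    InfinitePlace.card_filter_mk_eq]

/-- An embedding of `K` into `ℂ` has `[L : K]` extensions to `L`. -/
theorem Embeddings.card_filter_comp_algebraMap_eq (K L : Type*) [Field K] [NumberField K]
    [Field L] [NumberField L] [Algebra K L] (φ : K →+* ℂ)
    [DecidablePred fun σ : L →+* ℂ => σ.comp (algebraMap K L) = φ] :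
    (Finset.univ.filter fun σ : L →+* ℂ => σ.comp (algebraMap K L) = φ).card =
      Module.finrank K L := by
  let : Algebra K ℂ := φ.toAlgebra
  have : FiniteDimensional K L := .right ℚ K L
  rw [← AlgHom.card K L ℂ, ← Fintype.card_subtype]
  refine Fintype.card_congr
    { toFun := fun σ => { σ.1 with commutes' := fun a => RingHom.congr_fun σ.2 a }
      invFun := fun σ => ⟨σ.toRingHom, RingHom.ext σ.commutes⟩
      left_inv := fun σ => rfl
      right_inv := fun σ => rfl }

/-- The local degrees of the infinite places `w` above `v` add up to `[L : K]` times that of `v`,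
in multiplicative form. -/
theorem InfinitePlace.prod_comap_pow_mult {K L : Type*} [Field K] [NumberField K]
    [Field L] [NumberField L] [Algebra K L] {M : Type*} [CommMonoid M] (f : InfinitePlace K → M) :
    ∏ w : InfinitePlace L, f (w.comap (algebraMap K L)) ^ w.mult =
      (∏ v : InfinitePlace K, f v ^ v.mult) ^ Module.finrank K L := by
  classical
  rw [InfinitePlace.prod_pow_mult_eq_prod_embeddings f,
    InfinitePlace.prod_pow_mult_eq_prod_embeddings fun w => f (w.comap (algebraMap K L)),
    ← Finset.prod_fiberwise Finset.univ (fun σ : L →+* ℂ => σ.comp (algebraMap K L)),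
    ← Finset.prod_pow]
  refine Finset.prod_congr rfl fun φ _ => ?_
  rw [Finset.prod_congr rfl (g := fun _ => f (InfinitePlace.mk φ)) (fun σ hσ => by
      rw [InfinitePlace.comap_mk, (Finset.mem_filter.1 hσ).2]), Finset.prod_const,
    Embeddings.card_filter_comp_algebraMap_eq]

/-- Base change for the height of a tuple of algebraic integers. For such a tuple the finite part of
the height is the inverse of the norm of the ideal that it generates, so no decomposition of primes
is needed. -/
theorem mulHeight_algebraMap_comp_ringOfIntegers {K L : Type*} [Field K] [NumberField K]
    [Field L] [NumberField L] [Algebra K L] {ι : Type*} [Finite ι] {x : ι → 𝓞 K} (hx : x ≠ 0) :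
    Height.mulHeight (fun i => algebraMap K L (x i)) =
      Height.mulHeight (fun i => (x i : K)) ^ Module.finrank K L := by
  have hxK : (fun i => (x i : K)) ≠ 0 := fun h => hx <| funext fun i =>
    RingOfIntegers.ext (congrFun h i)
  have hxL : (fun i => algebraMap K L (x i)) ≠ 0 := fun h => hxK <| funext fun i =>
    (algebraMap K L).injective (by simpa using congrFun h i)
  let y : ι → 𝓞 L := fun i => algebraMap (𝓞 K) (𝓞 L) (x i)
  have hy : y ≠ 0 := fun h => hxL <| funext fun i => congrArg (algebraMap (𝓞 L) L) (congrFun h i)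
  have hnorm : (Ideal.span (Set.range y)).absNorm =
      (Ideal.span (Set.range x)).absNorm ^ Module.finrank K L := by
    rw [IsFractionRing.finrank_eq (𝓞 K) K (𝓞 L) L,
      ← Ideal.absNorm_algebraMap, Ideal.map_span, ← Set.range_comp]
    rfl
  have hK := absNorm_mul_finprod_finitePlace_eq_one hx
  have hL := absNorm_mul_finprod_finitePlace_eq_one hy
  have hfin : ∏ᶠ v : FinitePlace L, ⨆ i, v (algebraMap K L (x i)) =
      (∏ᶠ v : FinitePlace K, ⨆ i, v (x i)) ^ Module.finrank K L := by
    have h0 : ((Ideal.span (Set.range y)).absNorm : ℝ) ≠ 0 := left_ne_zero_of_mul_eq_one hL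
    refine mul_left_cancel₀ h0 (hL.trans ?_)
    rw [hnorm, Nat.cast_pow, ← mul_pow, hK, one_pow]
  rw [mulHeight_eq hxK, mulHeight_eq hxL, mul_pow, hfin,
    ← InfinitePlace.prod_comap_pow_mult (L := L) fun v => ⨆ i, v (x i : K)]
  rfl

theorem mulHeight₁_algebraMap {K L : Type*} [Field K] [NumberField K]
    [Field L] [NumberField L] [Algebra K L] (a : K) :
    Height.mulHeight₁ (algebraMap K L a) = Height.mulHeight₁ a ^ Module.finrank K L := by
  obtain ⟨b, c, hc, rfl⟩ := IsFractionRing.div_surjective (A := 𝓞 K) a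
  have hc0 : c ≠ 0 := nonZeroDivisors.ne_zero hc
  have h := mulHeight_algebraMap_comp_ringOfIntegers (L := L) (x := ![b, c])
    (fun h => hc0 (congrFun h 1))
  rw [map_div₀, Height.mulHeight₁_div_eq_mulHeight, Height.mulHeight₁_div_eq_mulHeight]
  convert h using 2
  · ext i; fin_cases i <;> rfl
  · congr 1; ext i; fin_cases i <;> rfl

/-- A bound on the absolute height computed in a large field descends to any smaller field that
contains the element: take roots in the base change formula. -/
theorem mulHeight₁_le_pow_of_inclusion_le {Ω : Type*} [Field Ω] [CharZero Ω]
    {E K : IntermediateField ℚ Ω} [NumberField E] [NumberField K] (h : E ≤ K) (b : E) {C : ℝ}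
    (hC : 0 ≤ C)
    (hb : Height.mulHeight₁ (IntermediateField.inclusion h b) ≤ C ^ Module.finrank ℚ K) :
    Height.mulHeight₁ b ≤ C ^ Module.finrank ℚ E := by
  let : Algebra E K := (IntermediateField.inclusion h).toAlgebra
  have : IsScalarTower ℚ E K := .of_algebraMap_eq fun _ => rfl
  have : FiniteDimensional E K := .right ℚ E K
  have hbase := NumberField.mulHeight₁_algebraMap (L := K) b
  have hn : Module.finrank E K ≠ 0 := Module.finrank_pos.ne'
  rw [← pow_le_pow_iff_left₀ (Height.mulHeight₁_nonneg b) (pow_nonneg hC _) hn, ← hbase, ← pow_mul,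
    Module.finrank_mul_finrank]
  exact hb

theorem InfinitePlace.apply_le_mulHeight₁ {K : Type*} [Field K] [NumberField K]
    (v : InfinitePlace K) (a : K) : v a ≤ Height.mulHeight₁ a := by
  rw [mulHeight₁_eq]
  have h1 (w : InfinitePlace K) : 1 ≤ max (w a) 1 ^ w.mult := one_le_pow₀ (le_max_right _ _)
  calc v a ≤ max (v a) 1 ^ v.mult :=
        (le_max_left _ _).trans (le_self_pow₀ (le_max_right _ _) InfinitePlace.mult_ne_zero)
    _ ≤ ∏ w : InfinitePlace K, max (w a) 1 ^ w.mult := by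
        rw [← Finset.prod_singleton (fun w : InfinitePlace K => max (w a) 1 ^ w.mult) v]
        exact Finset.prod_le_prod_of_subset_of_one_le (Finset.subset_univ _)
          (fun w _ => zero_le_one.trans (h1 w)) fun w _ _ => h1 w
    _ ≤ _ := le_mul_of_one_le_right (Finset.prod_nonneg fun w _ => zero_le_one.trans (h1 w))
        (one_le_finprod fun _ => le_max_right _ _)

/-! ### Northcott's theorem for bounded degree -/

open Polynomial in
/-- Algebraic integers of bounded degree with bounded conjugates are finite in number: their minimal
polynomials have bounded degree and bounded integer coefficients. -/
theorem finite_setOf_isIntegral_norm_le_of_finrank_le (Ω : Type*) [Field Ω] [CharZero Ω]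
    (D : ℕ) (B : ℝ) :
    {a : Ω | ∃ (K : IntermediateField ℚ Ω) (_ : NumberField K) (b : K), (b : Ω) = a ∧
      Module.finrank ℚ K ≤ D ∧ IsIntegral ℤ b ∧ ∀ φ : K →+* ℂ, ‖φ b‖ ≤ B}.Finite := by
  classical
  let C := ⌈max B 1 ^ D * 2 ^ D⌉₊
  refine (bUnion_roots_finite (algebraMap ℤ Ω) D (Set.finite_Icc (-C : ℤ) C)).subset ?_
  rintro _ ⟨K, _, b, rfl, hD, hb, hB⟩
  simp_rw [Set.mem_iUnion]
  have hmin := minpoly.isIntegrallyClosed_eq_field_fractions' ℚ hb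
  refine ⟨minpoly ℤ b, ⟨?_, fun i => ?_⟩, ?_⟩
  · rw [← (minpoly.monic hb).natDegree_map (algebraMap ℤ ℚ), ← hmin]
    exact (minpoly.natDegree_le b).trans hD
  · rw [Set.mem_Icc, ← abs_le, ← @Int.cast_le ℝ]
    have hcoeff := Embeddings.coeff_bdd_of_norm_le hB i
    rw [hmin, coeff_map, eq_intCast, Int.norm_cast_rat, Int.norm_eq_abs, ← Int.cast_abs] at hcoeff
    refine (hcoeff.trans ?_).trans (Nat.le_ceil _)
    gcongr ?_ * ?_
    · exact pow_le_pow_right₀ (le_max_right _ _) hD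
    · exact_mod_cast (Nat.choose_le_two_pow _ _).trans (Nat.pow_le_pow_right two_pos hD)
  · refine mem_rootSet.2 ⟨minpoly.ne_zero hb, ?_⟩
    have h := congrArg (algebraMap K Ω) (minpoly.aeval ℤ b)
    rwa [← aeval_algebraMap_apply, map_zero] at h

/-- Northcott's theorem in a field `Ω` of characteristic zero. The height and the degree are those of
any number field inside `Ω` that contains the element. -/
theorem finite_setOf_mulHeight₁_le_of_finrank_le (Ω : Type*) [Field Ω] [CharZero Ω]
    (D : ℕ) (B : ℝ) :
    {a : Ω | ∃ (K : IntermediateField ℚ Ω) (_ : NumberField K) (b : K), (b : Ω) = a ∧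
      Module.finrank ℚ K ≤ D ∧ Height.mulHeight₁ b ≤ B}.Finite := by
  -- An element has a denominator `n ≤ B` and conjugates bounded by `B`, so `n * b` is integral with
  -- conjugates bounded by `B * B`.
  have hfin (n : ℕ) (hn : n ≠ 0) :=
    (finite_setOf_isIntegral_norm_le_of_finrank_le Ω D (B * B)).preimage
      (mul_right_injective₀ (Nat.cast_ne_zero.2 hn : (n : Ω) ≠ 0)).injOn
  refine ((Set.finite_Icc 1 ⌊B⌋₊).biUnion' fun n hn =>
    hfin n (Nat.one_le_iff_ne_zero.1 (Set.mem_Icc.1 hn).1)).subset ?_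
  rintro _ ⟨K, _, b, rfl, hD, hB⟩
  obtain ⟨n, hn0, hn, hint⟩ := exists_nat_le_mulHeight₁ b
  have hnB : (n : ℝ) ≤ B := hn.trans hB
  simp only [Set.mem_iUnion]
  refine ⟨n, ⟨Nat.one_le_iff_ne_zero.2 hn0, Nat.le_floor hnB⟩, K, inferInstance, n * b, by simp,
    hD, hint, fun φ => ?_⟩
  rw [map_mul, map_natCast, norm_mul, Complex.norm_natCast]
  have hφ : ‖φ b‖ ≤ B := (InfinitePlace.apply_le_mulHeight₁ (InfinitePlace.mk φ) b).trans hB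
  gcongr
  exact n.cast_nonneg.trans hnB

end NumberField

/-! ### The weighted height as a height in projective space -/

namespace WeightedProj

theorem mul_coWeight {n : ℕ} (w : Fin (n + 1) → ℕ) (j : Fin (n + 1)) :
    w j * coWeight w j = ∏ l, w l :=
  Finset.mul_prod_erase _ _ (Finset.mem_univ j)

theorem coWeight_pos {n : ℕ} {w : Fin (n + 1) → ℕ} (hw : ∀ i, 0 < w i) (j : Fin (n + 1)) :
    0 < coWeight w j :=
  Finset.prod_pos fun l _ => hw l

/-- Taking `q`-th powers, with `q` the product of the weights, turns the exponents `m / w i` of the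
local factor into `m * (q / w i)`. -/
theorem iSup_rpow_pow_prod {n : ℕ} {w : Fin (n + 1) → ℕ} (hw : ∀ i, 0 < w i)
    {a : Fin (n + 1) → ℝ} (ha : ∀ i, 0 ≤ a i) (m : ℕ) :
    (⨆ i, a i ^ ((m : ℝ) / (w i : ℝ))) ^ (∏ l, w l) = (⨆ i, a i ^ coWeight w i) ^ m := by
  rw [Real.iSup_pow fun i => Real.rpow_nonneg (ha i) _, Real.iSup_pow fun i => pow_nonneg (ha i) _]
  refine iSup_congr fun i => ?_
  have hwi : (w i : ℝ) ≠ 0 := Nat.cast_ne_zero.2 (hw i).ne'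
  rw [← mul_coWeight w i, ← Real.rpow_natCast, ← Real.rpow_mul (ha i), ← pow_mul,
    ← Real.rpow_natCast]
  congr 1
  push_cast
  field_simp

/-- The `q`-th power of the weighted height of `x` is the projective height of the vector with
entries `x i ^ (q / w i)`. -/
theorem weightedHeight_pow_prod {n : ℕ} {w : Fin (n + 1) → ℕ} (hw : ∀ i, 0 < w i)
    {K : Type*} [Field K] [NumberField K] {x : Fin (n + 1) → K} (hx : x ≠ 0) :
    weightedHeight w K x ^ (∏ l, w l) = Height.mulHeight fun i => x i ^ coWeight w i := by
  obtain ⟨i₀, hi₀⟩ := Function.ne_iff.1 hx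
  have hz : (fun i => x i ^ coWeight w i) ≠ 0 := Function.ne_iff.2 ⟨i₀, pow_ne_zero _ hi₀⟩
  have hq : (∏ l, w l) ≠ 0 := (Finset.prod_pos fun l _ => hw l).ne'
  have hfin (v : FinitePlace K) : (⨆ i, v (x i) ^ ((1 : ℝ) / (w i : ℝ))) ^ (∏ l, w l) =
      ⨆ i, v (x i ^ coWeight w i) := by
    simpa using iSup_rpow_pow_prod hw (fun i => apply_nonneg v (x i)) 1
  have hsupp : (fun v : FinitePlace K => ⨆ i, v (x i ^ coWeight w i)).HasFiniteMulSupport := by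
    have : Nonempty {j // x j ^ coWeight w j ≠ 0} := ⟨⟨i₀, pow_ne_zero _ hi₀⟩⟩
    simp_rw [Finite.iSup_eq_iSup_subtype hz]
    exact .iSup fun i => FinitePlace.hasFiniteMulSupport i.2
  have hsupp' : (fun v : FinitePlace K =>
      ⨆ i, v (x i) ^ ((1 : ℝ) / (w i : ℝ))).HasFiniteMulSupport := by
    refine hsupp.subset fun v hv hv' => hv ?_
    replace hv' := (hfin v).trans hv'
    exact (pow_eq_one_iff_of_nonneg
      (Real.iSup_nonneg fun i => Real.rpow_nonneg (apply_nonneg v _) _) hq).1 hv'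
  rw [weightedHeight, mul_pow, ← Finset.prod_pow, finprod_pow hsupp', mulHeight_eq hz]
  simp_rw [hfin, iSup_rpow_pow_prod hw (fun i => apply_nonneg _ (x i)), map_pow]

theorem weightedHeight_nonneg {n : ℕ} (w : Fin (n + 1) → ℕ)
    {K : Type*} [Field K] [NumberField K] (x : Fin (n + 1) → K) :
    0 ≤ weightedHeight w K x :=
  mul_nonneg
    (Finset.prod_nonneg fun v _ => Real.iSup_nonneg fun _ => Real.rpow_nonneg (apply_nonneg v _) _)
    (finprod_nonneg fun v => Real.iSup_nonneg fun _ => Real.rpow_nonneg (apply_nonneg v _) _)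

theorem mulHeight₁_div_le_weightedHeight_pow {n : ℕ} {w : Fin (n + 1) → ℕ} (hw : ∀ i, 0 < w i)
    {K : Type*} [Field K] [NumberField K] {x : Fin (n + 1) → K} (hx : x ≠ 0)
    (i j : Fin (n + 1)) :
    Height.mulHeight₁ (x j ^ coWeight w j / x i ^ coWeight w i) ≤
      weightedHeight w K x ^ (∏ l, w l) := by
  rw [weightedHeight_pow_prod hw hx, Height.mulHeight₁_div_eq_mulHeight]
  convert Height.mulHeight_comp_le ![j, i] fun i => x i ^ coWeight w i using 2
  ext k; fin_cases k <;> rfl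

/-! ### The ratios of the coordinates -/

theorem absHeightVec_nonneg {Qbar : Type*} [Field Qbar] [CharZero Qbar] [IsAlgClosure ℚ Qbar]
    {n : ℕ} (w : Fin (n + 1) → ℕ) (x : Fin (n + 1) → Qbar) : 0 ≤ absHeightVec w x :=
  Real.rpow_nonneg (weightedHeight_nonneg _ _) _

theorem absHeightVec_pow_finrank {Qbar : Type*} [Field Qbar] [CharZero Qbar]
    [IsAlgClosure ℚ Qbar] {n : ℕ} (w : Fin (n + 1) → ℕ) (x : Fin (n + 1) → Qbar) :
    absHeightVec w x ^ Module.finrank ℚ (coordField x) =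
      weightedHeight w (coordField x) (coordInField x) := by
  rw [absHeightVec, one_div,
    Real.rpow_inv_natCast_pow (weightedHeight_nonneg _ _) Module.finrank_pos.ne']

/-- If the ratio `u = z j / z i` lies in `F`, then over `E = ℚ(u)` its degree is at most that of `F`
and its height is bounded by the weighted height of `x`. -/
theorem exists_mulHeight₁_coordRatio_le {Qbar : Type*} [Field Qbar] [CharZero Qbar]
    [IsAlgClosure ℚ Qbar] {n : ℕ} {w : Fin (n + 1) → ℕ} (hw : ∀ i, 0 < w i)
    {x : Fin (n + 1) → Qbar} (hx : x ≠ 0) (i j : Fin (n + 1)) {F : IntermediateField ℚ Qbar}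
    [FiniteDimensional ℚ F] (hF : x j ^ coWeight w j / x i ^ coWeight w i ∈ F) :
    ∃ (E : IntermediateField ℚ Qbar) (_ : NumberField E) (b : E),
      (b : Qbar) = x j ^ coWeight w j / x i ^ coWeight w i ∧
      Module.finrank ℚ E ≤ Module.finrank ℚ F ∧
      Height.mulHeight₁ b ≤ (absHeightVec w x ^ (∏ l, w l)) ^ Module.finrank ℚ E := by
  set u := x j ^ coWeight w j / x i ^ coWeight w i
  let E : IntermediateField ℚ Qbar := IntermediateField.adjoin ℚ {u}
  have hEF : E ≤ F := IntermediateField.adjoin_le_iff.2 (Set.singleton_subset_iff.2 hF)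
  have : FiniteDimensional ℚ E :=
    .of_injective (IntermediateField.inclusion hEF).toLinearMap
      (IntermediateField.inclusion_injective hEF)
  have hE : NumberField E := { to_finiteDimensional := by convert this }
  have hxK (k : Fin (n + 1)) : x k ∈ coordField x := (coordInField x k).2
  have hEK : E ≤ coordField x := IntermediateField.adjoin_le_iff.2 <| Set.singleton_subset_iff.2 <|
    div_mem (pow_mem (hxK j) _) (pow_mem (hxK i) _)
  have hcoord : coordInField x ≠ 0 := fun h => hx <| funext fun k =>
    congrArg Subtype.val (congrFun h k)
  let b : E := ⟨u, IntermediateField.mem_adjoin_simple_self ℚ u⟩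
  refine ⟨E, hE, b, rfl, ?_, NumberField.mulHeight₁_le_pow_of_inclusion_le hEK b
    (pow_nonneg (absHeightVec_nonneg w x) _) ?_⟩
  · exact LinearMap.finrank_le_finrank_of_injective
      (f := (IntermediateField.inclusion hEF).toLinearMap)
      (IntermediateField.inclusion_injective hEF)
  -- Over `ℚ(x 0, …, x n)` the bound is that on the height of the projective vector `z`.
  · rw [pow_right_comm, absHeightVec_pow_finrank]
    exact mulHeight₁_div_le_weightedHeight_pow hw hcoord i j

/-- Finitely many points have all their ratios `z j / z i`, for some `i`, in a given finite set. -/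
theorem finite_setOf_coordRatio_mem {Ω : Type*} [Field Ω] [IsAlgClosed Ω] {n : ℕ}
    {w : Fin (n + 1) → ℕ} (hw : ∀ i, 0 < w i) {S : Set Ω} (hS : S.Finite) :
    {p : WPSpace w Ω | ∃ (x : NonzeroVec n Ω) (i : Fin (n + 1)), WPSpace.mk w x = p ∧ x.1 i ≠ 0 ∧
      ∀ j, x.1 j ^ coWeight w j / x.1 i ^ coWeight w i ∈ S}.Finite := by
  classical
  have hT (j : Fin (n + 1)) : {t : Ω | t ^ coWeight w j ∈ S}.Finite :=
    hS.preimage' fun s _ => (Polynomial.nthRoots (coWeight w j) s).toFinset.finite_toSet.subset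
      fun t ht => by simpa [Polynomial.mem_nthRoots (coWeight_pos hw j)] using ht
  refine (((Set.Finite.pi' hT).preimage Subtype.val_injective.injOn).image
    (WPSpace.mk w)).subset ?_
  rintro _ ⟨x, i, rfl, hi, hS⟩
  -- Scaling by the inverse of a `w i`-th root of `x i` moves coordinate `i` to `1`.
  obtain ⟨μ, hμ⟩ := IsAlgClosed.exists_pow_nat_eq (x.1 i) (hw i)
  have hμ0 : μ ≠ 0 := by
    rintro rfl
    exact hi (by rw [← hμ, zero_pow (hw i).ne'])
  let lam : Ωˣ := (Units.mk0 μ hμ0)⁻¹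
  let y : NonzeroVec n Ω := ⟨fun j => (lam : Ω) ^ w j * x.1 j, fun h => by
    simpa [hi] using congrFun h i⟩
  have hxy : WPSpace.mk w y = WPSpace.mk w x :=
    (Quotient.sound (s := weightedSetoid w Ω) ⟨lam, fun _ => rfl⟩).symm
  refine ⟨y, fun j => ?_, hxy⟩
  have hyj : y.1 j ^ coWeight w j = x.1 j ^ coWeight w j / x.1 i ^ coWeight w i := by
    simp only [y, lam, mul_pow, ← pow_mul, ← hμ, mul_coWeight, Units.val_inv_eq_inv_val,
      Units.val_mk0, inv_pow]
    rw [div_eq_inv_mul]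
  exact Set.mem_ofPred.2 (hyj ▸ hS j)

theorem coordRatio_eq_of_mk_eq {F : Type*} [Field F] {n : ℕ} {w : Fin (n + 1) → ℕ}
    {x y : NonzeroVec n F} (h : WPSpace.mk w x = WPSpace.mk w y) (i j : Fin (n + 1)) :
    x.1 j ^ coWeight w j / x.1 i ^ coWeight w i = y.1 j ^ coWeight w j / y.1 i ^ coWeight w i := by
  obtain ⟨lam, hlam⟩ := Quotient.exact (s := weightedSetoid w F) h
  simp only [hlam, mul_pow, ← pow_mul, mul_coWeight]
  rw [mul_div_mul_left _ _ (pow_ne_zero _ lam.ne_zero)]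

end WeightedProj

/-! ### Finiteness of the set of points -/

/-- Finiteness of the set of points of bounded absolute weighted height and bounded degree of the
field of definition; a point counts as soon as one choice of roots gives a field of degree at
most `d₀`. The field `Qbar` is any algebraic closure of `ℚ`. -/
theorem mainTheorem1 {Qbar : Type*} [Field Qbar] [CharZero Qbar] [IsAlgClosure ℚ Qbar]
    (n : ℕ) (w : Fin (n + 1) → ℕ) (hw : ∀ i, 0 < w i) (c₀ d₀ : ℝ) :
    {p : WeightedProj.WPSpace w Qbar |
      WeightedProj.absHeight p ≤ c₀ ∧
        ∃ F : IntermediateField ℚ Qbar,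
          WeightedProj.IsFieldOfDefinition p F ∧ (Module.finrank ℚ F : ℝ) ≤ d₀}.Finite := by
  have : IsAlgClosed Qbar := IsAlgClosure.isAlgClosed ℚ
  refine (WeightedProj.finite_setOf_coordRatio_mem hw
    (NumberField.finite_setOf_mulHeight₁_le_of_finrank_le Qbar ⌊d₀⌋₊
      (max (c₀ ^ (∏ l, w l)) 1 ^ ⌊d₀⌋₊))).subset ?_
  rintro p ⟨hc, F, ⟨x, hxp, i, hi, y, -, hy, rfl⟩, hd⟩
  refine ⟨x, i, hxp, hi, fun j => ?_⟩
  -- Without finiteness of `ℚ(y 0, …, y n)` the value `0` of `finrank` would make `hd` void.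
  have : FiniteDimensional ℚ (IntermediateField.adjoin ℚ (Set.range y)) :=
    WeightedProj.coordField_finiteDimensional y
  have hratio := WeightedProj.coordRatio_eq_of_mk_eq (hxp.trans p.mk_rep.symm) i j
  have hF : p.rep.1 j ^ WeightedProj.coWeight w j / p.rep.1 i ^ WeightedProj.coWeight w i ∈
      IntermediateField.adjoin ℚ (Set.range y) := by
    rw [← hratio, ← hy j]
    exact pow_mem (IntermediateField.subset_adjoin ℚ (Set.range y) ⟨j, rfl⟩) _
  obtain ⟨E, hE, b, hb, hdeg, hH⟩ :=
    WeightedProj.exists_mulHeight₁_coordRatio_le hw p.rep.2 i j hF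
  have hdeg' : Module.finrank ℚ E ≤ ⌊d₀⌋₊ := hdeg.trans (Nat.le_floor hd)
  refine ⟨E, hE, b, hb.trans hratio.symm, hdeg', hH.trans ?_⟩
  have h0 := WeightedProj.absHeightVec_nonneg w p.rep.1
  -- The maximum with `1` makes the bound monotone in the exponent `[E : ℚ]`.
  calc (WeightedProj.absHeightVec w p.rep.1 ^ (∏ l, w l)) ^ Module.finrank ℚ E
      ≤ max (c₀ ^ (∏ l, w l)) 1 ^ Module.finrank ℚ E :=
        pow_le_pow_left₀ (pow_nonneg h0 _)
          ((pow_le_pow_left₀ h0 hc _).trans (le_max_left _ _)) _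
    _ ≤ _ := pow_le_pow_right₀ (le_max_right _ _) hdeg'
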